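/- Theorem 1.3. Let $k\ge 1$ be an integer, and for each integer $m\ge1$ consider a Pólya urn that initially contains $A_0^{(m)}$ white and $B_0^{(m)}$ black balls, where $A_0^{(m)},B_0^{(m)}\in\{0,1,2,\dots\}$ and $A_0^{(m)}+B_0^{(m)}>0$: at each drawing a ball is picked uniformly at random from the urn and is returned together with $k$ additional balls of the same color. Let $A_n^{(m)}$ be the number of white balls in the urn after $n$ drawings. Assume that $$\lim_{m\to\infty}\frac{A_0^{(m)}}{m}=a,\qquad \lim_{m\to\infty}\frac{B_0^{(m)}}{m}=b,$$ where $a,b\in[0,\infty)$ are not both zero. Then, as $m\to\infty$, the process $\big(A^{(m)}_{[mt]}/m\big)_{t\ge0}$ converges in distribution, in the space $D_{\mathbb R}[0,\infty)$ of right-continuous functions $[0,\infty)\to\mathbb R$ with left limits, endowed with the Skorokhod ($J_1$) topology, to the deterministic process $$X_t=\frac{a}{a+b}\,(a+b+kt),\qquad t\ge0.$$ Here $[x]$ denotes the integer part of $x$. -/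

import Mathlib

open MeasureTheory ProbabilityTheory Filter Topology
open scoped NNReal

/-- A function `f : [0, ∞) → ℝ` is càdlàg: at each point it is right continuous and has a
(finite) limit from the left (at `t = 0` the filter `𝓝[<] 0` is trivial, so nothing is asked). -/
def IsCadlagPath (f : ℝ≥0 → ℝ) : Prop :=
  ∀ t : ℝ≥0, ContinuousWithinAt f (Set.Ici t) t ∧ ∃ l : ℝ, Tendsto f (𝓝[<] t) (𝓝 l)

/-- The space `D_ℝ[0, ∞)` of càdlàg functions `[0, ∞) → ℝ`. -/
structure CadlagPath where
  toFun : ℝ≥0 → ℝ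
  cadlag : IsCadlagPath toFun

namespace CadlagPath

/-- The paths `y` for which there is a time change `τ`, that is, a strictly increasing bijection
of `[0, ∞)` onto itself, such that `|τ(t) - t| < ε` and `|y(τ(t)) - x(t)| < ε` for all
`t ∈ [0, T]`. -/
def skorokhodBall (x : CadlagPath) (T : ℝ≥0) (ε : ℝ) : Set CadlagPath :=
  {y | ∃ τ : ℝ≥0 ≃o ℝ≥0, ∀ t ≤ T, |(τ t : ℝ) - (t : ℝ)| < ε ∧ |y.toFun (τ t) - x.toFun t| < ε}

theorem skorokhodBall_mono (x : CadlagPath) {T T' : ℝ≥0} {ε ε' : ℝ} (hT : T ≤ T') (hε : ε' ≤ ε) :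
    x.skorokhodBall T' ε' ⊆ x.skorokhodBall T ε := by
  rintro y ⟨τ, h⟩
  exact ⟨τ, fun t ht => ⟨(h t (ht.trans hT)).1.trans_le hε, (h t (ht.trans hT)).2.trans_le hε⟩⟩

/-- The Skorokhod (J1) topology on `D_ℝ[0, ∞)`: the sets `skorokhodBall x T ε`, with `T` large and
`ε > 0` small, generate the neighbourhoods of `x`. Thus `xₙ → x` if and only if for each `T` there
are time changes `τₙ` with `sup_{t ≤ T} |τₙ(t) - t| → 0` and
`sup_{t ≤ T} |xₙ(τₙ(t)) - x(t)| → 0`. -/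
instance : TopologicalSpace CadlagPath where
  IsOpen U := ∀ x ∈ U, ∃ T : ℝ≥0, ∃ ε : ℝ, 0 < ε ∧ x.skorokhodBall T ε ⊆ U
  isOpen_univ := fun _ _ => ⟨0, 1, one_pos, Set.subset_univ _⟩
  isOpen_inter := by
    intro U V hU hV x hx
    obtain ⟨T, ε, hε, h⟩ := hU x hx.1
    obtain ⟨T', ε', hε', h'⟩ := hV x hx.2
    exact ⟨max T T', min ε ε', lt_min hε hε', Set.subset_inter
      ((x.skorokhodBall_mono (le_max_left _ _) (min_le_left _ _)).trans h)
      ((x.skorokhodBall_mono (le_max_right _ _) (min_le_right _ _)).trans h')⟩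
  isOpen_sUnion := by
    intro S hS x hx
    obtain ⟨U, hU, hxU⟩ := hx
    obtain ⟨T, ε, hε, h⟩ := hS U hU x hxU
    exact ⟨T, ε, hε, h.trans (Set.subset_sUnion_of_mem hU)⟩

/-- `D_ℝ[0, ∞)` carries the Borel σ-algebra of the Skorokhod topology. -/
instance : MeasurableSpace CadlagPath := borel CadlagPath

instance : BorelSpace CadlagPath := ⟨rfl⟩

theorem isCadlagPath_of_continuous {f : ℝ≥0 → ℝ} (hf : Continuous f) : IsCadlagPath f :=
  fun t => ⟨hf.continuousWithinAt, f t, hf.continuousAt.tendsto.mono_left nhdsWithin_le_nhds⟩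

theorem isCadlagPath_floor (u : ℕ → ℝ) {c : ℝ≥0} (hc : 0 < c) :
    IsCadlagPath (fun t : ℝ≥0 => u ⌊c * t⌋₊) := by
  intro t
  constructor
  · have h1 : ∀ᶠ s in 𝓝[≥] t, c * s < (⌊c * t⌋₊ : ℝ≥0) + 1 := by
      apply mem_nhdsWithin_of_mem_nhds
      have : Continuous fun s : ℝ≥0 => c * s := by fun_prop
      exact (this.tendsto t).eventually_lt_const (Nat.lt_floor_add_one _)
    have h2 : ∀ᶠ s in 𝓝[≥] t, t ≤ s := self_mem_nhdsWithin
    refine (tendsto_const_nhds (x := u ⌊c * t⌋₊)).congr' ?_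
    filter_upwards [h1, h2] with s hs hts
    have : ⌊c * s⌋₊ = ⌊c * t⌋₊ := by
      rw [Nat.floor_eq_iff (zero_le)]
      exact ⟨(Nat.floor_le (zero_le)).trans (by gcongr), hs⟩
    rw [this]
  · refine ⟨u (⌈c * t⌉₊ - 1), ?_⟩
    have h2 : ∀ᶠ s in 𝓝[<] t, s < t := self_mem_nhdsWithin
    rcases eq_or_ne t 0 with rfl | ht
    · have : 𝓝[<] (0 : ℝ≥0) = ⊥ := by simp
      rw [this]; exact tendsto_bot
    have hpos : 0 < c * t := mul_pos hc (pos_iff_ne_zero.mpr ht)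
    have hn : 1 ≤ ⌈c * t⌉₊ := Nat.ceil_pos.mpr hpos
    have hlt : ((⌈c * t⌉₊ - 1 : ℕ) : ℝ≥0) < c * t := Nat.lt_ceil.mp (by omega)
    have h1 : ∀ᶠ s in 𝓝[<] t, ((⌈c * t⌉₊ - 1 : ℕ) : ℝ≥0) < c * s := by
      apply mem_nhdsWithin_of_mem_nhds
      have : Continuous fun s : ℝ≥0 => c * s := by fun_prop
      exact (this.tendsto t).eventually_const_lt hlt
    refine (tendsto_const_nhds (x := u (⌈c * t⌉₊ - 1))).congr' ?_
    filter_upwards [h1, h2] with s hs hst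
    have : ⌊c * s⌋₊ = ⌈c * t⌉₊ - 1 := by
      rw [Nat.floor_eq_iff (zero_le)]
      refine ⟨hs.le, ?_⟩
      have h3 : c * s < c * t := by gcongr
      have h4 : c * t ≤ (⌈c * t⌉₊ : ℝ≥0) := Nat.le_ceil _
      have h5 : (((⌈c * t⌉₊ - 1 : ℕ) : ℝ≥0) + 1) = (⌈c * t⌉₊ : ℝ≥0) := by
        exact_mod_cast Nat.sub_add_cancel hn
      rw [h5]
      exact h3.trans_le h4
    rw [this]

/-- The càdlàg path `t ↦ u_{[mt]} / m` obtained from a sequence `u` of natural numbers. -/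
noncomputable def rescaled (m : ℕ+) (u : ℕ → ℕ) : CadlagPath where
  toFun t := (u ⌊(m : ℝ≥0) * t⌋₊ : ℝ) / (m : ℝ)
  cadlag := isCadlagPath_floor (fun n => (u n : ℝ) / (m : ℝ)) (by exact_mod_cast m.pos)

/-- The path `t ↦ a / (a + b) * (a + b + k t)`. -/
noncomputable def linearLimit (k : ℕ) (a b : ℝ) : CadlagPath where
  toFun t := a / (a + b) * (a + b + (k : ℝ) * (t : ℝ))
  cadlag := isCadlagPath_of_continuous (by fun_prop)

end CadlagPath

/-- The σ-algebra generated by the compositions `(A 0, B 0), …, (A n, B n)` of an urn. -/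
abbrev urnHistory {Ω : Type*} (A B : ℕ → Ω → ℕ) (n : ℕ) : MeasurableSpace Ω :=
  ⨆ i ≤ n, MeasurableSpace.comap (fun ω => (A i ω, B i ω)) inferInstance

/-- `A n` and `B n` are the numbers of white and black balls after `n` drawings from a Pólya urn
that has initially `r` white and `s` black balls (`r + s > 0`): at each drawing a ball is picked
uniformly at random and returned together with `k ≥ 1` balls of the same colour. So each drawing
adds either `k` white or `k` black balls, and the conditional probability of adding white ones,
given the past, is the current proportion of white balls. -/
structure IsPolyaUrn {Ω : Type*} [MeasurableSpace Ω] (μ : Measure Ω) (k r s : ℕ)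
    (A B : ℕ → Ω → ℕ) : Prop where
  measurable_white : ∀ n, Measurable (A n)
  measurable_black : ∀ n, Measurable (B n)
  white_zero : ∀ᵐ ω ∂μ, A 0 ω = r
  black_zero : ∀ᵐ ω ∂μ, B 0 ω = s
  step : ∀ n, ∀ᵐ ω ∂μ,
    (A (n + 1) ω = A n ω + k ∧ B (n + 1) ω = B n ω) ∨
      (A (n + 1) ω = A n ω ∧ B (n + 1) ω = B n ω + k)
  prob_white : ∀ n,
    μ⟦{ω | A (n + 1) ω = A n ω + k} | urnHistory A B n⟧
      =ᵐ[μ] fun ω => (A n ω : ℝ) / ((A n ω : ℝ) + (B n ω : ℝ))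

/-! After `n` drawings the urn holds `r + s + k n` balls almost surely, so only the proportion of
white balls is random. It is a martingale whose increments are at most `k / (r + s)`. Increments
being orthogonal, its variance after `n` drawings is at most `n (k / (r + s))²`. For `n ≤ m T` and
`r + s ∼ (a + b) m` this is `O(1 / m)`, so the maximal inequality
(`measure_exists_le_abs_proportion_sub`) keeps the proportion near `r / (r + s) → a / (a + b)`
throughout `[0, T]`.

Multiplying by the rescaled total, which is uniformly close to `a + b + k t`, gives uniform
closeness to the limit path on `[0, T]` with high probability (`rescaled_mem_skorokhodBall`). As the
limit is deterministic, this yields convergence in distribution (`tendstoInDistribution_const`). -/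

namespace IsPolyaUrn

variable {Ω : Type*} {k r s : ℕ} {A B : ℕ → Ω → ℕ}

/-! ### The proportion of white balls as a martingale -/

theorem measurable_white_urnHistory (n : ℕ) : Measurable[urnHistory A B n] (A n) := by
  have h1 : Measurable[MeasurableSpace.comap (fun ω => (A n ω, B n ω)) inferInstance] (A n) :=
    measurable_fst.comp (comap_measurable _)
  exact h1.mono (le_iSup₂_of_le n le_rfl le_rfl) le_rfl

/-- The proportion of white balls after `n` drawings, for the almost sure total `r + s + k n`. -/
noncomputable def proportion (k r s : ℕ) (A : ℕ → Ω → ℕ) (n : ℕ) (ω : Ω) : ℝ :=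
  (A n ω : ℝ) / ((r : ℝ) + s + k * n)

theorem measurable_proportion_urnHistory (n : ℕ) :
    Measurable[urnHistory A B n] (proportion k r s A n) :=
  ((measurable_from_top (f := fun x : ℕ => (x : ℝ))).comp
    (measurable_white_urnHistory n)).div_const _

theorem proportion_nonneg (n : ℕ) (ω : Ω) : 0 ≤ proportion k r s A n ω := by
  unfold proportion; positivity

variable [MeasurableSpace Ω] {μ : Measure Ω}

/-- The filtration generated by the compositions of the urn. -/
def filtration (h : IsPolyaUrn μ k r s A B) : Filtration ℕ ‹MeasurableSpace Ω› where
  seq := urnHistory A B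
  mono' := fun _ _ hij => biSup_mono fun _ hi => hi.trans hij
  le' := fun _ => iSup₂_le fun i _ =>
    ((h.measurable_white i).prodMk (h.measurable_black i)).comap_le

theorem ae_total (h : IsPolyaUrn μ k r s A B) (n : ℕ) :
    ∀ᵐ ω ∂μ, A n ω + B n ω = r + s + k * n := by
  induction n with
  | zero => filter_upwards [h.white_zero, h.black_zero] with ω h1 h2; simp [h1, h2]
  | succ n ih =>
    filter_upwards [ih, h.step n] with ω h1 h2
    rw [Nat.mul_succ]
    omega

theorem measurable_proportion (h : IsPolyaUrn μ k r s A B) (n : ℕ) :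
    Measurable (proportion k r s A n) :=
  (measurable_proportion_urnHistory (B := B) n).mono (h.filtration.le n) le_rfl

theorem ae_proportion_le_one (h : IsPolyaUrn μ k r s A B) (n : ℕ) :
    ∀ᵐ ω ∂μ, proportion k r s A n ω ≤ 1 := by
  filter_upwards [h.ae_total n] with ω hω
  refine div_le_one_of_le₀ ?_ (by positivity)
  have : A n ω ≤ r + s + k * n := by omega
  exact_mod_cast this

theorem ae_norm_proportion_le_one (h : IsPolyaUrn μ k r s A B) (n : ℕ) :
    ∀ᵐ ω ∂μ, ‖proportion k r s A n ω‖ ≤ 1 := by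
  filter_upwards [h.ae_proportion_le_one n] with ω hω
  rwa [Real.norm_of_nonneg (proportion_nonneg n ω)]

theorem integrable_proportion [IsFiniteMeasure μ] (h : IsPolyaUrn μ k r s A B) (n : ℕ) :
    Integrable (proportion k r s A n) μ :=
  .of_bound (h.measurable_proportion n).aestronglyMeasurable 1 (h.ae_norm_proportion_le_one n)

theorem integrable_proportion_mul [IsFiniteMeasure μ] (h : IsPolyaUrn μ k r s A B) (i j : ℕ) :
    Integrable (fun ω => proportion k r s A i ω * proportion k r s A j ω) μ := by
  refine .of_bound
    ((h.measurable_proportion i).mul (h.measurable_proportion j)).aestronglyMeasurable 1 ?_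
  filter_upwards [h.ae_norm_proportion_le_one i, h.ae_norm_proportion_le_one j] with ω hi hj
  rw [norm_mul]
  exact mul_le_one₀ hi (norm_nonneg _) hj

/-- The proportion after a drawing is a weighted mean of the previous proportion and of the
indicator of the event that white balls are added. -/
theorem ae_proportion_succ (h : IsPolyaUrn μ k r s A B) (hk : 0 < k) (hrs : 0 < r + s) (n : ℕ) :
    proportion k r s A (n + 1) =ᵐ[μ]
      (((r : ℝ) + s + k * n) / ((r : ℝ) + s + k * (n + 1))) • proportion k r s A n +
      ((k : ℝ) / ((r : ℝ) + s + k * (n + 1))) •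
        {ω | A (n + 1) ω = A n ω + k}.indicator (fun _ => (1 : ℝ)) := by
  have hrs' : (0 : ℝ) < r + s := by exact_mod_cast hrs
  have h0 : (0 : ℝ) < r + s + k * n := by positivity
  have h1 : (0 : ℝ) < r + s + k * (n + 1) := by positivity
  filter_upwards [h.step n] with ω hω
  simp only [Pi.add_apply, Pi.smul_apply, smul_eq_mul, proportion, Set.indicator_apply,
    Set.mem_ofPred_eq]
  push_cast
  rcases hω with ⟨ha, -⟩ | ⟨ha, -⟩
  · rw [if_pos ha, ha]
    push_cast
    field_simp
  -- Here `0 < k` is essential: it makes the two kinds of drawing exclusive.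
  · rw [if_neg (by omega), ha]
    field_simp
    ring

/-- Given the past, the indicator in `ae_proportion_succ` has mean equal to the current proportion,
and the two weights sum to 1. -/
theorem condExp_proportion_succ [IsFiniteMeasure μ] (h : IsPolyaUrn μ k r s A B) (hk : 0 < k)
    (hrs : 0 < r + s) (n : ℕ) :
    proportion k r s A n =ᵐ[μ] μ[proportion k r s A (n + 1) | urnHistory A B n] := by
  have hrs' : (0 : ℝ) < r + s := by exact_mod_cast hrs
  have h0 : (0 : ℝ) < r + s + k * n := by positivity
  have h1 : (0 : ℝ) < r + s + k * (n + 1) := by positivity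
  have hle : urnHistory A B n ≤ ‹MeasurableSpace Ω› := h.filtration.le n
  have hE : MeasurableSet {ω | A (n + 1) ω = A n ω + k} :=
    measurableSet_eq_fun (h.measurable_white _) ((h.measurable_white n).add_const k)
  have hI : Integrable ({ω | A (n + 1) ω = A n ω + k}.indicator fun _ => (1 : ℝ)) μ :=
    (integrable_const 1).indicator hE
  have e1 := condExp_congr_ae (m := urnHistory A B n) (h.ae_proportion_succ hk hrs n)
  have e2 := condExp_add ((h.integrable_proportion n).smul
    (((r : ℝ) + s + k * n) / ((r : ℝ) + s + k * (n + 1))))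
    (hI.smul ((k : ℝ) / ((r : ℝ) + s + k * (n + 1)))) (urnHistory A B n)
  have e3 := condExp_smul (μ := μ) (((r : ℝ) + s + k * n) / ((r : ℝ) + s + k * (n + 1)))
    (proportion k r s A n) (urnHistory A B n)
  have e4 := condExp_smul (μ := μ) ((k : ℝ) / ((r : ℝ) + s + k * (n + 1)))
    ({ω | A (n + 1) ω = A n ω + k}.indicator fun _ => (1 : ℝ)) (urnHistory A B n)
  rw [condExp_of_stronglyMeasurable hle (measurable_proportion_urnHistory n).stronglyMeasurable
    (h.integrable_proportion n)] at e3
  filter_upwards [e1, e2, e3, e4, h.prob_white n, h.ae_total n] with ω e1 e2 e3 e4 e5 e6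
  rw [e1, e2, Pi.add_apply, e3, e4, Pi.smul_apply, Pi.smul_apply, e5, smul_eq_mul, smul_eq_mul,
    proportion]
  have e6' : (A n ω : ℝ) + B n ω = r + s + k * n := by exact_mod_cast e6
  rw [e6']
  field_simp
  ring

theorem martingale_proportion [IsFiniteMeasure μ] (h : IsPolyaUrn μ k r s A B) (hk : 0 < k)
    (hrs : 0 < r + s) : Martingale (proportion k r s A) h.filtration μ :=
  martingale_nat (fun n => (measurable_proportion_urnHistory n).stronglyMeasurable)
    h.integrable_proportion (h.condExp_proportion_succ hk hrs)

/-! ### Second moments and the maximal inequality -/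

/-- Orthogonality of the increment to the present value, which makes second moments of increments
telescope. -/
theorem integral_proportion_mul_succ [IsProbabilityMeasure μ] (h : IsPolyaUrn μ k r s A B)
    (hk : 0 < k) (hrs : 0 < r + s) (n : ℕ) :
    ∫ ω, proportion k r s A n ω * proportion k r s A (n + 1) ω ∂μ =
      ∫ ω, proportion k r s A n ω ^ 2 ∂μ := by
  have hle : urnHistory A B n ≤ ‹MeasurableSpace Ω› := h.filtration.le n
  rw [← integral_condExp hle]
  refine integral_congr_ae ?_
  have e := condExp_mul_of_stronglyMeasurable_left (m := urnHistory A B n)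
    (measurable_proportion_urnHistory (k := k) (r := r) (s := s) n).stronglyMeasurable
    (h.integrable_proportion_mul n (n + 1)) (h.integrable_proportion (n + 1))
  filter_upwards [e, h.condExp_proportion_succ hk hrs n] with ω e1 e2
  refine e1.trans ?_
  rw [Pi.mul_apply, ← e2, sq]

/-- The increment is `k / (r + s + k (n + 1))` times the indicator minus the proportion, a factor in
`[-1, 1]`. Dropping `k (n + 1)` is harmless, since `r + s` will already be of order `m`. -/
theorem ae_sq_proportion_succ_sub_le (h : IsPolyaUrn μ k r s A B) (hk : 0 < k) (hrs : 0 < r + s)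
    (n : ℕ) : ∀ᵐ ω ∂μ, (proportion k r s A (n + 1) ω - proportion k r s A n ω) ^ 2 ≤
      ((k : ℝ) / (r + s)) ^ 2 := by
  have hrs' : (0 : ℝ) < r + s := by exact_mod_cast hrs
  have h0 : (0 : ℝ) < r + s + k * n := by positivity
  have h1 : (0 : ℝ) < r + s + k * (n + 1) := by positivity
  filter_upwards [h.ae_proportion_succ hk hrs n, h.ae_proportion_le_one n] with ω e1 e2
  have e3 : 0 ≤ proportion k r s A n ω := proportion_nonneg n ω
  set I := {ω | A (n + 1) ω = A n ω + k}.indicator (fun _ => (1 : ℝ)) ω with hI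
  have i0 : 0 ≤ I := Set.indicator_nonneg (fun _ _ => zero_le_one) _
  have i1 : I ≤ 1 := Set.indicator_le_self' (fun _ _ => zero_le_one) _
  have e4 : proportion k r s A (n + 1) ω - proportion k r s A n ω =
      k / (r + s + k * (n + 1)) * (I - proportion k r s A n ω) := by
    rw [e1]
    simp only [Pi.add_apply, Pi.smul_apply, smul_eq_mul, ← hI]
    field_simp
    ring
  rw [sq_le_sq, e4, abs_mul, abs_of_pos (show (0 : ℝ) < k / (r + s + k * (n + 1)) by positivity),
    abs_of_pos (show (0 : ℝ) < k / (r + s) by positivity)]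
  calc _ ≤ (k : ℝ) / (r + s + k * (n + 1)) * 1 := by
        gcongr
        rw [abs_le]
        constructor <;> linarith
    _ ≤ _ := by
        rw [mul_one]
        have : (0 : ℝ) ≤ k * (n + 1) := by positivity
        exact div_le_div_of_nonneg_left (by positivity) hrs' (by linarith)

theorem ae_proportion_zero (h : IsPolyaUrn μ k r s A B) :
    ∀ᵐ ω ∂μ, proportion k r s A 0 ω = (r : ℝ) / (r + s) := by
  filter_upwards [h.white_zero] with ω hω
  simp [proportion, hω]

theorem integral_sq_proportion_le [IsProbabilityMeasure μ] (h : IsPolyaUrn μ k r s A B)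
    (hk : 0 < k) (hrs : 0 < r + s) (n : ℕ) :
    ∫ ω, proportion k r s A n ω ^ 2 ∂μ ≤ ((r : ℝ) / (r + s)) ^ 2 + n * ((k : ℝ) / (r + s)) ^ 2 := by
  have hint : ∀ n, Integrable (fun ω => proportion k r s A n ω ^ 2) μ := fun n => by
    simpa only [sq] using h.integrable_proportion_mul n n
  induction n with
  | zero =>
    refine le_of_eq ?_
    rw [integral_congr_ae (g := fun _ => ((r : ℝ) / (r + s)) ^ 2)]
    · simp
    · filter_upwards [h.ae_proportion_zero] with ω hω
      rw [hω]
  | succ n ih =>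
    have e1 : ∫ ω, (proportion k r s A (n + 1) ω - proportion k r s A n ω) ^ 2 ∂μ =
        ∫ ω, proportion k r s A (n + 1) ω ^ 2 ∂μ - ∫ ω, proportion k r s A n ω ^ 2 ∂μ := by
      calc _ = ∫ ω, (proportion k r s A (n + 1) ω ^ 2 + proportion k r s A n ω ^ 2 -
            2 * (proportion k r s A n ω * proportion k r s A (n + 1) ω)) ∂μ := by
            congr 1; ext ω; ring
        _ = _ := by
            have hsum : Integrable (fun ω => proportion k r s A (n + 1) ω ^ 2 +
                proportion k r s A n ω ^ 2) μ := (hint _).add (hint _)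
            rw [integral_sub hsum ((h.integrable_proportion_mul n (n + 1)).const_mul 2),
              integral_add (hint _) (hint _), integral_const_mul,
              h.integral_proportion_mul_succ hk hrs n]
            ring
    have e2 : ∫ ω, (proportion k r s A (n + 1) ω - proportion k r s A n ω) ^ 2 ∂μ ≤
        ((k : ℝ) / (r + s)) ^ 2 := by
      refine (integral_mono_of_nonneg (.of_forall fun ω => sq_nonneg _)
        (integrable_const (((k : ℝ) / (r + s)) ^ 2))
        (h.ae_sq_proportion_succ_sub_le hk hrs n)).trans ?_
      simp
    push_cast
    linarith

theorem integral_proportion [IsProbabilityMeasure μ] (h : IsPolyaUrn μ k r s A B)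
    (hk : 0 < k) (hrs : 0 < r + s) (n : ℕ) :
    ∫ ω, proportion k r s A n ω ∂μ = (r : ℝ) / (r + s) := by
  have e := (h.martingale_proportion hk hrs).setIntegral_eq (Nat.zero_le n) MeasurableSet.univ
  rw [setIntegral_univ, setIntegral_univ] at e
  rw [← e, integral_congr_ae (g := fun _ => (r : ℝ) / (r + s)) h.ae_proportion_zero]
  simp

theorem integral_sq_proportion_sub_le [IsProbabilityMeasure μ] (h : IsPolyaUrn μ k r s A B)
    (hk : 0 < k) (hrs : 0 < r + s) (n : ℕ) :
    ∫ ω, (proportion k r s A n ω - (r : ℝ) / (r + s)) ^ 2 ∂μ ≤ n * ((k : ℝ) / (r + s)) ^ 2 := by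
  have hint : Integrable (fun ω => proportion k r s A n ω ^ 2) μ := by
    simpa only [sq] using h.integrable_proportion_mul n n
  have e : ∫ ω, (proportion k r s A n ω - (r : ℝ) / (r + s)) ^ 2 ∂μ =
      ∫ ω, (proportion k r s A n ω ^ 2 - 2 * ((r : ℝ) / (r + s)) * proportion k r s A n ω +
        ((r : ℝ) / (r + s)) ^ 2) ∂μ := by
    congr 1; ext ω; ring
  have h1 := (h.integrable_proportion n).const_mul (2 * ((r : ℝ) / (r + s)))
  have h2 : Integrable (fun ω => proportion k r s A n ω ^ 2 -
      2 * ((r : ℝ) / (r + s)) * proportion k r s A n ω) μ := hint.sub h1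
  rw [e, integral_add h2 (integrable_const _), integral_sub hint h1,
    integral_const_mul, h.integral_proportion hk hrs]
  have := h.integral_sq_proportion_le hk hrs n
  simp only [integral_const, probReal_univ, one_smul]
  linarith

/-- A maximal inequality for the deviation of the proportion of white balls from its mean. -/
theorem measure_exists_le_abs_proportion_sub [IsProbabilityMeasure μ]
    (h : IsPolyaUrn μ k r s A B) (hk : 0 < k) (hrs : 0 < r + s) (n : ℕ) {c : ℝ} (hc : 0 < c)
    (hnc : n * ((k : ℝ) / (r + s)) ^ 2 ≤ c ^ 2) {ε : ℝ≥0} (hε : 0 < ε) :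
    μ {ω | ∃ i ≤ n, (ε : ℝ) ≤ |proportion k r s A i ω - (r : ℝ) / (r + s)|} ≤
      ENNReal.ofReal (c / ε) := by
  set p : ℝ := (r : ℝ) / (r + s)
  have hM := (h.martingale_proportion hk hrs).sub (martingale_const h.filtration μ p)
  have hsub := hM.submartingale.sup hM.neg.submartingale
  -- Since `|x| = x ⊔ -x`, the absolute deviation is a nonnegative submartingale.
  set f := (proportion k r s A - fun _ _ => p) ⊔ -(proportion k r s A - fun _ _ => p) with hf
  have hfa : ∀ i ω, f i ω = |proportion k r s A i ω - p| := fun i ω => rfl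
  have hmax := maximal_ineq hsub (fun i ω => by rw [hfa]; exact abs_nonneg _) (ε := ε) n
  have hset : {ω | ∃ i ≤ n, (ε : ℝ) ≤ |proportion k r s A i ω - p|} =
      {ω | (ε : ℝ) ≤ (Finset.range (n + 1)).sup' Finset.nonempty_range_add_one
        fun k => f k ω} := by
    ext ω
    simp only [Set.mem_ofPred_eq, Finset.le_sup'_iff, Finset.mem_range, Nat.lt_succ_iff, hfa]
  rw [← hset] at hmax
  have hsq : Integrable (fun ω => (proportion k r s A n ω - p) ^ 2) μ := by
    have h1 := (h.integrable_proportion n).const_mul (2 * p)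
    refine ((((h.integrable_proportion_mul n n).sub h1)).add
      (integrable_const (p ^ 2))).congr (.of_forall fun ω => ?_)
    simp only [Pi.add_apply, Pi.sub_apply]
    ring
  -- In place of Cauchy–Schwarz: `|x| ≤ c / 2 + x² / (2 c)`, from `(|x| - c)² ≥ 0`.
  have hint : ∫ ω, |proportion k r s A n ω - p| ∂μ ≤ c := by
    have hb : ∫ ω, |proportion k r s A n ω - p| ∂μ ≤
        ∫ ω, (c / 2 + (2 * c)⁻¹ * (proportion k r s A n ω - p) ^ 2) ∂μ := by
      refine integral_mono ((h.integrable_proportion n).sub (integrable_const p)).abs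
        ((integrable_const _).add (hsq.const_mul _)) fun ω => ?_
      have : 0 ≤ (2 * c)⁻¹ * (|proportion k r s A n ω - p| - c) ^ 2 := by positivity
      have h2 : (2 * c)⁻¹ * (|proportion k r s A n ω - p| - c) ^ 2 =
          c / 2 + (2 * c)⁻¹ * (proportion k r s A n ω - p) ^ 2 -
            |proportion k r s A n ω - p| := by
        rw [← sq_abs (proportion k r s A n ω - p)]
        field_simp
        ring
      simp only
      linarith
    rw [integral_add (integrable_const _) (hsq.const_mul _), integral_const_mul] at hb
    have h3 : (2 * c)⁻¹ * ∫ ω, (proportion k r s A n ω - p) ^ 2 ∂μ ≤ (2 * c)⁻¹ * c ^ 2 := by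
      gcongr
      exact (h.integral_sq_proportion_sub_le hk hrs n).trans hnc
    have h4 : (2 * c)⁻¹ * c ^ 2 = c / 2 := by field_simp
    simp only [integral_const, probReal_univ, one_smul] at hb
    linarith
  have hle : (ε : ENNReal) * μ {ω | ∃ i ≤ n, (ε : ℝ) ≤ |proportion k r s A i ω - p|} ≤
      ENNReal.ofReal c := by
    refine hmax.trans (ENNReal.ofReal_le_ofReal (le_trans ?_ hint))
    exact setIntegral_le_integral (hsub.integrable n) (.of_forall fun ω => abs_nonneg _)
  rw [ENNReal.ofReal_div_of_pos (by exact_mod_cast hε), ENNReal.ofReal_coe_nnreal,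
    ENNReal.le_div_iff_mul_le (by simp [hε.ne']) (by simp), mul_comm]
  exact hle

end IsPolyaUrn

/-! ### Skorokhod balls, measurability and convergence to a constant -/

namespace CadlagPath

theorem mem_skorokhodBall_of_forall_abs_sub_lt {x y : CadlagPath} {T : ℝ≥0} {ε : ℝ} (hε : 0 < ε)
    (h : ∀ t ≤ T, |y.toFun t - x.toFun t| < ε) : y ∈ x.skorokhodBall T ε :=
  ⟨OrderIso.refl _, fun t ht => ⟨by simpa using hε, h t ht⟩⟩

theorem exists_skorokhodBall_subset {x : CadlagPath} {U : Set CadlagPath} (hU : IsOpen U)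
    (hx : x ∈ U) : ∃ T : ℝ≥0, ∃ ε : ℝ, 0 < ε ∧ x.skorokhodBall T ε ⊆ U :=
  hU x hx

/-- On `[0, T]` the path depends on finitely many terms of `u`. These are discrete, so sequences
near `u` give the same path there. -/
theorem continuous_rescaled (m : ℕ+) : Continuous (rescaled m) := by
  refine continuous_def.mpr fun U hU => isOpen_iff_mem_nhds.mpr fun u hu => ?_
  obtain ⟨T, ε, hε, hsub⟩ := exists_skorokhodBall_subset hU hu
  have hev : ∀ᶠ v in 𝓝 u, ∀ n ∈ Finset.range (⌊(m : ℝ≥0) * T⌋₊ + 1), v n = u n :=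
    (Finset.eventually_all _).mpr fun n _ =>
      (continuous_apply n).continuousAt.eventually ((isOpen_discrete {u n}).mem_nhds rfl)
  filter_upwards [hev] with v hv
  refine hsub (mem_skorokhodBall_of_forall_abs_sub_lt hε fun t ht => ?_)
  have : v ⌊(m : ℝ≥0) * t⌋₊ = u ⌊(m : ℝ≥0) * t⌋₊ :=
    hv _ (Finset.mem_range.mpr (Nat.lt_succ_of_le (Nat.floor_mono (by gcongr))))
  simpa [rescaled, this] using hε

theorem measurable_rescaled (m : ℕ+) : Measurable (rescaled m) :=
  (continuous_rescaled m).measurable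

/-- Convergence in probability to a deterministic path, in terms of Skorokhod balls, implies
convergence in distribution. -/
theorem tendstoInDistribution_const {ι : Type*} {l : Filter ι} [l.IsCountablyGenerated]
    {Ω : ι → Type*} [∀ i, MeasurableSpace (Ω i)] {μ : (i : ι) → Measure (Ω i)}
    [∀ i, IsProbabilityMeasure (μ i)] {Ω' : Type*} [MeasurableSpace Ω'] {μ' : Measure Ω'}
    [IsProbabilityMeasure μ'] {X : (i : ι) → Ω i → CadlagPath} {x : CadlagPath}
    (hX : ∀ i, Measurable (X i))
    (h : ∀ (T : ℝ≥0) (ε : ℝ), 0 < ε →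
      Tendsto (fun i => μ i {ω | X i ω ∉ x.skorokhodBall T ε}) l (𝓝 0)) :
    TendstoInDistribution X l (fun _ => x) μ μ' where
  forall_aemeasurable i := (hX i).aemeasurable
  aemeasurable_limit := aemeasurable_const
  tendsto := by
    -- Portmanteau: if `x ∈ F` the limit mass is 1 and the bound is trivial; otherwise some ball
    -- about `x` misses `F`.
    refine tendsto_of_forall_isClosed_limsup_le' fun F hF => ?_
    simp only [ProbabilityMeasure.coe_mk]
    rw [Measure.map_const, measure_univ, one_smul, Measure.dirac_apply' _ hF.measurableSet]
    by_cases hx : x ∈ F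
    · simp only [hx, Set.indicator_of_mem, Pi.one_apply]
      refine limsup_le_of_le (h := .of_forall fun i => ?_)
      have := Measure.isProbabilityMeasure_map (hX i).aemeasurable (μ := μ i)
      exact prob_le_one
    · obtain ⟨T, ε, hε, hsub⟩ := exists_skorokhodBall_subset hF.isOpen_compl hx
      rcases l.eq_or_neBot with rfl | hl
      · simp
      have hlim : Tendsto (fun i => (μ i).map (X i) F) l (𝓝 0) := by
        refine tendsto_of_tendsto_of_tendsto_of_le_of_le tendsto_const_nhds (h T ε hε)
          (fun _ => zero_le) fun i => ?_
        rw [Measure.map_apply (hX i) hF.measurableSet]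
        -- Monotonicity holds for outer measure, so the ball need not be measurable.
        exact measure_mono fun ω hω hmem => hsub hmem hω
      rw [hlim.limsup_eq]
      exact zero_le

end CadlagPath

/-! ### The pathwise estimate and the limit `m → ∞` -/

theorem IsPolyaUrn.rescaled_mem_skorokhodBall {Ω : Type*} {k r s : ℕ} {A : ℕ → Ω → ℕ} {ω : Ω}
    (hrs : 0 < r + s) {a b : ℝ} (ha : 0 ≤ a) (hb : 0 ≤ b) {m : ℕ+} {T : ℝ≥0}
    {δ K ε : ℝ} (hε : 0 < ε) (hK : ((r : ℝ) + s) / m + k * T ≤ K) (hab : 0 < a + b)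
    (h : ∀ i ≤ ⌊(m : ℝ≥0) * T⌋₊, |IsPolyaUrn.proportion k r s A i ω - (r : ℝ) / (r + s)| < δ)
    (hsmall : (δ + |(r : ℝ) / (r + s) - a / (a + b)|) * K + |((r : ℝ) + s) / m - (a + b)| +
      (k : ℝ) / m < ε) :
    CadlagPath.rescaled m (fun n => A n ω) ∈
      (CadlagPath.linearLimit k a b).skorokhodBall T ε := by
  refine CadlagPath.mem_skorokhodBall_of_forall_abs_sub_lt hε fun t ht => ?_
  have hm : (0 : ℝ) < m := by exact_mod_cast m.pos
  have hrs' : (0 : ℝ) < r + s := by exact_mod_cast hrs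
  set i := ⌊(m : ℝ≥0) * t⌋₊ with hi
  have hi1 : (i : ℝ) ≤ m * t := by
    exact_mod_cast Nat.floor_le (zero_le : 0 ≤ (m : ℝ≥0) * t)
  have hi2 : (m : ℝ) * t < i + 1 := by
    exact_mod_cast Nat.lt_floor_add_one ((m : ℝ≥0) * t)
  have hM := h i (Nat.floor_mono (by gcongr))
  set M := IsPolyaUrn.proportion k r s A i ω with hMdef
  set p := (r : ℝ) / (r + s)
  set q := a / (a + b)
  have hq0 : 0 ≤ q := by positivity
  have hq1 : q ≤ 1 := div_le_one_of_le₀ (by linarith) hab.le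
  set N := ((r : ℝ) + s) / m + k * (i / m) with hN
  have hN0 : 0 ≤ N := by positivity
  have hit : (i : ℝ) / m ≤ t := by rw [div_le_iff₀ hm]; linarith
  have hit' : (t : ℝ) - i / m ≤ 1 / m := by
    rw [sub_le_iff_le_add, ← add_div, le_div_iff₀ hm]; linarith
  have htT : (t : ℝ) ≤ T := by exact_mod_cast ht
  have hNK : N ≤ K := by
    refine le_trans ?_ hK
    rw [hN]
    gcongr
    exact hit.trans htT
  have hA : (A i ω : ℝ) / m = M * N := by
    have h0 : (0 : ℝ) < r + s + k * i := by positivity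
    rw [hMdef, IsPolyaUrn.proportion, hN]
    field_simp
  have hkt : |(k : ℝ) * (i / m) - k * t| ≤ k / m := by
    rw [← mul_sub, abs_mul, abs_of_nonneg (by positivity : (0 : ℝ) ≤ k), abs_sub_comm,
      abs_of_nonneg (by linarith), div_eq_mul_one_div (k : ℝ)]
    gcongr
  -- Three errors: fluctuation of the proportion, bias of the initial proportion, and error in the
  -- total, including at most `k / m` from the integer part.
  have hsplit : M * N - q * (a + b + k * t) =
      (M - p) * N + (p - q) * N + q * ((((r : ℝ) + s) / m - (a + b)) + (k * (i / m) - k * t)) := by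
    rw [hN]; ring
  change |(A i ω : ℝ) / m - q * (a + b + k * t)| < ε
  rw [hA, hsplit]
  refine lt_of_le_of_lt ?_ hsmall
  have b1 : |(M - p) * N| ≤ δ * K := by
    rw [abs_mul, abs_of_nonneg hN0]
    exact mul_le_mul hM.le hNK hN0 ((abs_nonneg _).trans hM.le)
  have b2 : |(p - q) * N| ≤ |p - q| * K := by
    rw [abs_mul, abs_of_nonneg hN0]
    gcongr
  have b3 : |q * ((((r : ℝ) + s) / m - (a + b)) + (k * (i / m) - k * t))| ≤
      |((r : ℝ) + s) / m - (a + b)| + k / m := by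
    rw [abs_mul, abs_of_nonneg hq0]
    refine (mul_le_of_le_one_left (abs_nonneg _) hq1).trans ((abs_add_le _ _).trans ?_)
    exact add_le_add le_rfl hkt
  calc _ ≤ |(M - p) * N| + |(p - q) * N| + _ := abs_add_three _ _ _
    _ ≤ _ := by linarith

theorem PNat.tendsto_coe_real_atTop : Tendsto (fun m : ℕ+ => (m : ℝ)) atTop atTop :=
  tendsto_natCast_atTop_atTop.comp tendsto_PNat_val_atTop_atTop

theorem theorem1p3 (k : ℕ) (hk : 0 < k) (A₀ B₀ : ℕ+ → ℕ) (hne : ∀ m, 0 < A₀ m + B₀ m)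
    (a b : ℝ) (ha : 0 ≤ a) (hb : 0 ≤ b) (hab : ¬(a = 0 ∧ b = 0))
    (hA₀ : Tendsto (fun m : ℕ+ => (A₀ m : ℝ) / (m : ℝ)) atTop (𝓝 a))
    (hB₀ : Tendsto (fun m : ℕ+ => (B₀ m : ℝ) / (m : ℝ)) atTop (𝓝 b))
    {Ω : ℕ+ → Type*} [∀ m, MeasurableSpace (Ω m)] (μ : (m : ℕ+) → Measure (Ω m))
    [∀ m, IsProbabilityMeasure (μ m)] (A B : (m : ℕ+) → ℕ → Ω m → ℕ)
    (hurn : ∀ m, IsPolyaUrn (μ m) k (A₀ m) (B₀ m) (A m) (B m)) :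
    TendstoInDistribution
      (fun m ω => CadlagPath.rescaled m (fun n => A m n ω)) atTop
      (fun _ : Unit => CadlagPath.linearLimit k a b) μ (Measure.dirac ()) := by
  refine CadlagPath.tendstoInDistribution_const (fun m => (CadlagPath.measurable_rescaled m).comp
    (measurable_pi_lambda _ (hurn m).measurable_white)) fun T ε hε => ?_
  have hab' : 0 < a + b := by
    rcases ha.lt_or_eq with h | h
    · linarith
    · rcases hb.lt_or_eq with h' | h'
      · linarith
      · exact absurd ⟨h.symm, h'.symm⟩ hab
  have hm0 : ∀ m : ℕ+, (0 : ℝ) < m := fun m => by exact_mod_cast m.pos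
  have hne' : ∀ m, (0 : ℝ) < A₀ m + B₀ m := fun m => by exact_mod_cast hne m
  have hN : Tendsto (fun m : ℕ+ => ((A₀ m : ℝ) + B₀ m) / m) atTop (𝓝 (a + b)) := by
    simpa only [add_div] using hA₀.add hB₀
  have hp : Tendsto (fun m : ℕ+ => (A₀ m : ℝ) / (A₀ m + B₀ m)) atTop (𝓝 (a / (a + b))) := by
    refine (hA₀.div hN hab'.ne').congr fun m => ?_
    rw [Pi.div_apply, div_div_div_cancel_right₀ (hm0 m).ne']
  have hminv : Tendsto (fun m : ℕ+ => (k : ℝ) / m) atTop (𝓝 0) :=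
    PNat.tendsto_coe_real_atTop.const_div_atTop _
  -- `K` eventually bounds the rescaled total on `[0, T]`, the 1 being slack. Then `δ K = ε / 2`
  -- leaves `ε / 2` for the vanishing errors.
  set K : ℝ := a + b + 1 + k * T with hKdef
  have hK0 : 0 < K := by positivity
  set δ : ℝ≥0 := ⟨ε / (2 * K), by positivity⟩ with hδdef
  have hδ0 : 0 < δ := by
    rw [← NNReal.coe_pos]
    exact (by positivity : 0 < ε / (2 * K))
  have hKev : ∀ᶠ m : ℕ+ in atTop, ((A₀ m : ℝ) + B₀ m) / m + k * T ≤ K := by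
    filter_upwards [hN.eventually_le_const (by linarith : a + b < a + b + 1)] with m h
    linarith
  have hsmall : ∀ᶠ m : ℕ+ in atTop,
      (δ + |(A₀ m : ℝ) / (A₀ m + B₀ m) - a / (a + b)|) * K +
        |((A₀ m : ℝ) + B₀ m) / m - (a + b)| + (k : ℝ) / m < ε := by
    have hlim := (((((hp.sub_const (a / (a + b))).abs.const_add (δ : ℝ)).mul_const K).add
      (hN.sub_const (a + b)).abs).add hminv)
    refine hlim.eventually_lt_const ?_
    have : (δ : ℝ) * K = ε / 2 := by
      change ε / (2 * K) * K = ε / 2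
      field_simp
    simp only [sub_self, abs_zero, add_zero, this]
    linarith
  -- Root of the variance bound, of order `m^(-1/2)`; `T + 1` instead of `T` keeps it positive when
  -- `T = 0`.
  set c : ℕ+ → ℝ := fun m => √(m * (T + 1)) * (k / (A₀ m + B₀ m)) with hc
  have hc0 : ∀ m, 0 < c m := fun m => by
    have := hm0 m
    have := hne' m
    positivity
  have hclim : Tendsto c atTop (𝓝 0) := by
    have h1 : Tendsto (fun m : ℕ+ => (√(m : ℝ))⁻¹) atTop (𝓝 0) :=
      (Real.tendsto_sqrt_atTop.comp PNat.tendsto_coe_real_atTop).inv_tendsto_atTop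
    have h2 := (h1.const_mul (√(T + 1) * k)).div hN hab'.ne'
    rw [mul_zero, zero_div] at h2
    refine h2.congr fun m => ?_
    have h3 := hm0 m
    have h4 := hne' m
    have h5 : √(m : ℝ) * √(m : ℝ) = m := Real.mul_self_sqrt h3.le
    have h6 : 0 < √(m : ℝ) := Real.sqrt_pos.mpr h3
    simp only [hc, Pi.div_apply]
    rw [Real.sqrt_mul h3.le]
    field_simp
    linear_combination (-1 : ℝ) * h5
  have hbound : Tendsto (fun m => ENNReal.ofReal (c m / δ)) atTop (𝓝 0) := by
    simpa using ENNReal.tendsto_ofReal (hclim.div_const (δ : ℝ))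
  refine tendsto_of_tendsto_of_tendsto_of_le_of_le' tendsto_const_nhds hbound
    (.of_forall fun _ => zero_le) ?_
  filter_upwards [hKev, hsmall] with m hKm hsm
  refine le_trans (measure_mono fun ω hω => ?_)
    ((hurn m).measure_exists_le_abs_proportion_sub hk (hne m) ⌊(m : ℝ≥0) * T⌋₊ (hc0 m) ?_ hδ0)
  · by_contra hcon
    simp only [Set.mem_ofPred_eq, not_exists, not_and, not_le] at hcon
    exact hω (IsPolyaUrn.rescaled_mem_skorokhodBall (hne m) ha hb hε hKm hab' hcon hsm)
  · have h3 := hm0 m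
    have hfl : (⌊(m : ℝ≥0) * T⌋₊ : ℝ) ≤ m * T := by
      exact_mod_cast Nat.floor_le (zero_le : 0 ≤ (m : ℝ≥0) * T)
    simp only [hc]
    rw [mul_pow, Real.sq_sqrt (by positivity)]
    gcongr
    linarith
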